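/- Let $E\neq\{0\}$ be a metrizable (in particular Hausdorff) locally convex space over $\mathbb R$ or $\mathbb C$ and let $X$ be a Tychonoff space. Let $B_0(X,E)=C(X,E)$; for a countable ordinal $\alpha>0$ let $B_\alpha(X,E)$ be the set of all pointwise limits of sequences from $\bigcup_{\beta<\alpha}B_\beta(X,E)$, and put $B(X,E)=\bigcup_{\alpha<\omega_1}B_\alpha(X,E)$. Let $B_1^{st,rc}(X,E)$ be the set of all functions $f:X\to E$ such that $f(X)$ is relatively compact in $E$ and there are continuous functions $f_n:X\to E$, $n\in\omega$, for which the set $\{n: f_n(x)\neq f(x)\}$ is finite for every $x\in X$. Let $H$ be a set of functions with $B_1^{st,rc}(X,E)\subseteq H\subseteq B(X,E)$, endowed with the topology of pointwise convergence (inherited from $E^X$). Then: (A) The following assertions are equivalent: (i) $H$ is metrizable; (ii) $H$ is a $\sigma$-space, i.e. it has a $\sigma$-locally finite network; (iii) $H$ has countable $cs^*$-character, i.e. for every $h\in H$ there is a countable family $\mathcal N$ of subsets of $H$ such that for every sequence $(h_n)$ in $H$ converging to $h$ and every neighborhood $O$ of $h$ there is $N\in\mathcal N$ with $h\in N\subseteq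 O$ and $\{n: h_n\in N\}$ infinite; (iv) $X$ is countable. (B) The following assertions are equivalent: (i) $H$ is a Fréchet–Urysohn space; (ii) $H$ is a sequential space; (iii) $H$ is a $k$-space; (iv) $H$ has countable tightness; (v) $X_{\aleph_0}$ has the property $\gamma$. Here $X_{\aleph_0}$ is the set $X$ with the Baire topology, whose base consists of all zero-sets of continuous real-valued functions on $X$. A space $Z$ has the property $\gamma$ if every family $\mathcal U$ of open subsets of $Z$ such that each finite subset of $Z$ is contained in a member of $\mathcal U$ contains a sequence $(U_n)_{n\in\omega}$ (repetitions allowed) such that every $z\in Z$ belongs to all but finitely many $U_n$. -/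

import Mathlib

open Set Filter Topology

namespace BaireFun

section FunctionClasses

variable {X Y : Type*} [TopologicalSpace X] [TopologicalSpace Y]

/-- `IsBaireOfClass α f`: the function `f` belongs to the Baire class `B_α(X, Y)`. The class `B_0`
consists of the continuous functions; for `α ≠ 0` the class `B_α` consists of the pointwise limits
of sequences from the union of the classes `B_β`, `β < α`. (The second constructor cannot be used
for `α = 0`, since no `β` is smaller than `0`.) -/
inductive IsBaireOfClass : Ordinal.{0} → (X → Y) → Prop
  | continuous {f : X → Y} (hf : Continuous f) : IsBaireOfClass 0 f
  | limit {α : Ordinal.{0}} {f : X → Y} (u : ℕ → X → Y) (β : ℕ → Ordinal.{0})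
      (hβ : ∀ n, β n < α) (hu : ∀ n, IsBaireOfClass (β n) (u n))
      (hlim : ∀ x, Tendsto (fun n => u n x) atTop (𝓝 (f x))) : IsBaireOfClass α f

/-- The sequence of functions `u` stably converges to `f`. -/
def StablyConverges (u : ℕ → X → Y) (f : X → Y) : Prop :=
  ∀ x, {n : ℕ | u n x ≠ f x}.Finite

variable (X Y)

/-- `B_α(X, Y)`. -/
def baireClass (α : Ordinal.{0}) : Set (X → Y) :=
  {f | IsBaireOfClass α f}

/-- `B(X, Y)`, the union of the classes `B_α(X, Y)` over all countable ordinals `α`. -/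
def baireFunctions : Set (X → Y) :=
  ⋃ α : Ordinal.{0}, ⋃ _ : α < Ordinal.omega 1, baireClass X Y α

/-- `B_1^st(X, Y)`: the limits of stably convergent sequences of continuous functions. -/
def stableBaireOne : Set (X → Y) :=
  {f | ∃ u : ℕ → X → Y, (∀ n, Continuous (u n)) ∧ StablyConverges u f}

/-- `B_1^{st,rc}(X, Y)`: the functions in `B_1^st(X, Y)` with relatively compact image. -/
def stableBaireOneRC : Set (X → Y) :=
  {f | f ∈ stableBaireOne X Y ∧ IsCompact (closure (range f))}

end FunctionClasses

section SpaceProperties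

variable {Z : Type*} [TopologicalSpace Z]

/-- A family of sets is a network in `Z`. -/
def IsNetwork (𝒩 : Set (Set Z)) : Prop :=
  ∀ z : Z, ∀ O ∈ 𝓝 z, ∃ N ∈ 𝒩, z ∈ N ∧ N ⊆ O

/-- A family of sets is locally finite: each point has a neighbourhood that meets only finitely
many members of the family. -/
def IsLocallyFiniteFamily (𝒩 : Set (Set Z)) : Prop :=
  ∀ z : Z, ∃ O ∈ 𝓝 z, {N ∈ 𝒩 | (N ∩ O).Nonempty}.Finite

/-- A family of sets is a `cs*`-network at the point `z`. -/
def IsCsStarNetworkAt (𝒩 : Set (Set Z)) (z : Z) : Prop :=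
  ∀ u : ℕ → Z, Tendsto u atTop (𝓝 z) → ∀ O ∈ 𝓝 z,
    ∃ N ∈ 𝒩, z ∈ N ∧ N ⊆ O ∧ {n : ℕ | u n ∈ N}.Infinite

/-- `𝒰` is an `ω`-cover of `Z`: every finite subset of `Z` lies in a member of `𝒰`. -/
def IsOmegaCover (𝒰 : Set (Set Z)) : Prop :=
  ∀ A : Set Z, A.Finite → ∃ U ∈ 𝒰, A ⊆ U

variable (Z)

/-- `Z` is a `σ`-space: it has a `σ`-locally finite network. -/
def IsSigmaSpace : Prop :=
  ∃ 𝒩 : ℕ → Set (Set Z), (∀ n, IsLocallyFiniteFamily (𝒩 n)) ∧ IsNetwork (⋃ n, 𝒩 n)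

/-- `Z` has countable `cs*`-character. -/
def HasCountableCsStarCharacter : Prop :=
  ∀ z : Z, ∃ 𝒩 : Set (Set Z), 𝒩.Countable ∧ IsCsStarNetworkAt 𝒩 z

/-- `Z` has countable tightness. -/
def HasCountableTightness : Prop :=
  ∀ (A : Set Z) (z : Z), z ∈ closure A → ∃ B ⊆ A, B.Countable ∧ z ∈ closure B

/-- `Z` has the property `γ`: every open `ω`-cover contains a sequence such that each point of `Z`
lies in all but finitely many of its terms. -/
def HasPropertyGamma : Prop :=
  ∀ 𝒰 : Set (Set Z), (∀ U ∈ 𝒰, IsOpen U) → IsOmegaCover 𝒰 →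
    ∃ U : ℕ → Set Z, (∀ n, U n ∈ 𝒰) ∧ ∀ z, ∀ᶠ n in atTop, z ∈ U n

end SpaceProperties

section BaireTopology

variable (X : Type*) [TopologicalSpace X]

/-- The zero-sets of `X`. -/
def zeroSets : Set (Set X) :=
  {S | ∃ f : X → ℝ, Continuous f ∧ S = f ⁻¹' {0}}

/-- The Baire topology on `X`, generated by the zero-sets of `X`; the set `X` with this topology
is `X_{ℵ₀}`. -/
@[reducible]
def baireTopology : TopologicalSpace X :=
  TopologicalSpace.generateFrom (zeroSets X)

/-- The zero-sets form a basis of the Baire topology. -/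
theorem isTopologicalBasis_zeroSets :
    @TopologicalSpace.IsTopologicalBasis X (baireTopology X) (zeroSets X) := by
  refine @TopologicalSpace.IsTopologicalBasis.mk X (baireTopology X) (zeroSets X) ?_ ?_ rfl
  · rintro _ ⟨f, hf, rfl⟩ _ ⟨g, hg, rfl⟩ x hx
    have hc : Continuous fun x => |f x| + |g x| := hf.abs.add hg.abs
    refine ⟨_, ⟨_, hc, rfl⟩, ?_, ?_⟩
    · have h1 : f x = 0 := hx.1
      have h2 : g x = 0 := hx.2
      simp [h1, h2]
    · intro y hy
      have h : |f y| + |g y| = 0 := hy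
      have h1 := abs_nonneg (f y)
      have h2 := abs_nonneg (g y)
      exact ⟨abs_eq_zero.mp (by linarith), abs_eq_zero.mp (by linarith)⟩
  · refine Set.eq_univ_of_forall fun x => ⟨univ, ⟨fun _ => 0, continuous_const, ?_⟩, mem_univ x⟩
    simp

end BaireTopology

end BaireFun

namespace BaireFun

/-! ### Zero-sets and functions locally constant on them -/

section ZeroSets

variable {X Y : Type*} [TopologicalSpace X] [TopologicalSpace Y]

/-! Only two facts about `H` are used. Since zero-sets are closed under countable intersections,
every Baire function is constant on a zero-set around each point
(`IsBaireOfClass.isZeroSetLocallyConstant`). In the other direction, `H` contains every function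
taking one value on a zero-set and another off it (`twoValued_mem_stableBaireOneRC`).

In (A), a countable `X` makes `E^X` metrizable. Conversely, a zero-set can avoid a given countable
set while containing a given outside point, so two-valued functions defeat any countable description
of neighbourhoods or of convergent sequences at a constant function.

In (B), property γ extracts convergent sequences directly, because approximation sets are open in
the Baire topology. Countable tightness turns ω-covers by zero-sets into countable ones, and
`HasCountableOmegaSubcovers.hasPropertyGamma` upgrades this to γ. The hard implication starts from a
k-space: locally countable subsets of the Baire topology are shown countable
(`countable_of_forall_exists_zeroSet`). A recursion of length ω₁ inside a compact set then gives the
Lindelöf property (`isBaireLindelof_of_compactlyCoherentSpace`), which passes to all finite powers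
and hence to ω-covers. -/

theorem fiber_mem_zeroSets [TopologicalSpace.MetrizableSpace Y] {f : X → Y} (hf : Continuous f)
    (y : Y) : f ⁻¹' {y} ∈ zeroSets X := by
  let := TopologicalSpace.metrizableSpaceMetric Y
  refine ⟨fun x => dist (f x) y, hf.dist continuous_const, ?_⟩
  ext x
  simp

theorem univ_mem_zeroSets : (univ : Set X) ∈ zeroSets X :=
  ⟨fun _ => 0, continuous_const, by simp⟩

theorem iInter_mem_zeroSets {ι : Type*} [Countable ι] {S : ι → Set X}
    (hS : ∀ i, S i ∈ zeroSets X) : (⋂ i, S i) ∈ zeroSets X := by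
  choose f hf hfS using hS
  convert fiber_mem_zeroSets (continuous_pi hf : Continuous fun x i => f i x) 0
  ext x
  simp [hfS, funext_iff]

theorem biInter_mem_zeroSets {ι : Type*} {C : Set ι} (hC : C.Countable) {S : ι → Set X}
    (hS : ∀ i ∈ C, S i ∈ zeroSets X) : (⋂ i ∈ C, S i) ∈ zeroSets X := by
  have := hC.to_subtype
  rw [biInter_eq_iInter]
  exact iInter_mem_zeroSets fun i => hS i i.2

theorem inter_mem_zeroSets {S T : Set X} (hS : S ∈ zeroSets X) (hT : T ∈ zeroSets X) :
    S ∩ T ∈ zeroSets X := by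
  rw [inter_eq_iInter]
  exact iInter_mem_zeroSets (Bool.rec hT hS)

theorem biUnion_mem_zeroSets {ι : Type*} {C : Set ι} (hC : C.Finite) {S : ι → Set X}
    (hS : ∀ i ∈ C, S i ∈ zeroSets X) : (⋃ i ∈ C, S i) ∈ zeroSets X := by
  induction C, hC using Set.Finite.induction_on with
  | empty => exact ⟨fun _ => 1, continuous_const, by simp⟩
  | @insert a C _ _ ih =>
    obtain ⟨f, hf, hfS⟩ := hS a (mem_insert _ _)
    obtain ⟨g, hg, hgS⟩ := ih fun i hi => hS i (mem_insert_of_mem _ hi)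
    refine ⟨fun x => f x * g x, hf.mul hg, ?_⟩
    rw [biUnion_insert, hfS, hgS]
    ext x
    simp

theorem isOpen_baireTopology_iff {U : Set X} :
    IsOpen[baireTopology X] U ↔ ∀ x ∈ U, ∃ S ∈ zeroSets X, x ∈ S ∧ S ⊆ U :=
  @TopologicalSpace.IsTopologicalBasis.isOpen_iff X (baireTopology X) U _
    (isTopologicalBasis_zeroSets X)

theorem exists_continuous_ne [T35Space X] {x y : X} (h : x ≠ y) :
    ∃ f : X → ℝ, Continuous f ∧ f x ≠ f y := by
  obtain ⟨f, hf, h0, h1⟩ := CompletelyRegularSpace.completely_regular x {y} isClosed_singleton h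
  refine ⟨fun z => f z, by fun_prop, ?_⟩
  have : f y = 1 := h1 rfl
  simp [h0, this]

theorem exists_continuous_injOn [T35Space X] (C : Set X) :
    ∃ Φ : X → (C × C → ℝ), Continuous Φ ∧ ∀ c ∈ C, ∀ d ∈ C, Φ c = Φ d → c = d := by
  have h : ∀ p : C × C, ∃ f : X → ℝ, Continuous f ∧ ((p.1 : X) ≠ p.2 → f p.1 ≠ f p.2) := by
    intro p
    by_cases hp : (p.1 : X) = p.2
    · exact ⟨fun _ => 0, continuous_const, fun h => absurd hp h⟩
    · obtain ⟨f, hf, hne⟩ := exists_continuous_ne hp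
      exact ⟨f, hf, fun _ => hne⟩
  choose f hf hne using h
  refine ⟨fun x p => f p x, continuous_pi hf, fun c hc d hd hcd => ?_⟩
  by_contra hcd'
  exact hne (⟨c, hc⟩, ⟨d, hd⟩) hcd' (congrFun hcd (⟨c, hc⟩, ⟨d, hd⟩))

/-- Countably many real functions separate the points of `C ∪ {x}`; the fibre through `x` of their
product is the zero-set. -/
theorem exists_zeroSet_disjoint [T35Space X] {C : Set X} (hC : C.Countable) {x : X}
    (hx : x ∉ C) : ∃ S ∈ zeroSets X, x ∈ S ∧ ∀ y ∈ S, y ∉ C := by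
  have hC' : (insert x C).Countable := hC.insert x
  have := hC'.to_subtype
  obtain ⟨Φ, hΦ, hinj⟩ := exists_continuous_injOn (insert x C)
  refine ⟨_, fiber_mem_zeroSets hΦ (Φ x), rfl, fun y hy hyC => hx ?_⟩
  rwa [hinj x (mem_insert _ _) y (mem_insert_of_mem _ hyC) (Eq.symm hy)]

/-- Each point has a zero-set neighbourhood on which the function is constant. -/
def IsZeroSetLocallyConstant {Y : Type*} (f : X → Y) : Prop :=
  ∀ x, ∃ S ∈ zeroSets X, x ∈ S ∧ ∀ y ∈ S, f y = f x

/-- Fibres of continuous functions are zero-sets; at a limit stage, intersect the zero-sets of the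
countably many terms. -/
theorem IsBaireOfClass.isZeroSetLocallyConstant [TopologicalSpace.MetrizableSpace Y]
    {α : Ordinal.{0}} {f : X → Y} (hf : IsBaireOfClass α f) : IsZeroSetLocallyConstant f := by
  induction hf with
  | @continuous f hf => exact fun x => ⟨_, fiber_mem_zeroSets hf (f x), rfl, fun y hy => hy⟩
  | @limit α f u β _ _ hlim ih =>
    intro x
    choose S hS hxS hconst using fun n => ih n x
    refine ⟨_, iInter_mem_zeroSets hS, mem_iInter.2 hxS, fun y hy => ?_⟩
    refine tendsto_nhds_unique (hlim y) ((hlim x).congr fun n => ?_)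
    exact (hconst n y (mem_iInter.1 hy n)).symm

theorem isZeroSetLocallyConstant_of_mem_baireFunctions [TopologicalSpace.MetrizableSpace Y]
    {f : X → Y} (hf : f ∈ baireFunctions X Y) : IsZeroSetLocallyConstant f := by
  simp only [baireFunctions, mem_iUnion] at hf
  obtain ⟨α, _, hf⟩ := hf
  exact IsBaireOfClass.isZeroSetLocallyConstant hf

end ZeroSets

/-! ### Two-valued functions of zero-sets -/

section TwoValued

variable {X Y : Type*}

open Classical in
/-- The function equal to `a` on `S` and to `b` off `S`. -/
noncomputable def twoValued (S : Set X) (a b : Y) (x : X) : Y :=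
  if x ∈ S then a else b

theorem twoValued_of_mem {S : Set X} {a b : Y} {x : X} (h : x ∈ S) : twoValued S a b x = a :=
  if_pos h

theorem twoValued_of_notMem {S : Set X} {a b : Y} {x : X} (h : x ∉ S) : twoValued S a b x = b :=
  if_neg h

theorem twoValued_mem_stableBaireOneRC {E : Type*} [TopologicalSpace X] [AddCommGroup E]
    [Module ℝ E] [TopologicalSpace E] [IsTopologicalAddGroup E] [ContinuousSMul ℝ E] [T2Space E]
    {S : Set X} (hS : S ∈ zeroSets X) (a b : E) : twoValued S a b ∈ stableBaireOneRC X E := by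
  obtain ⟨f, hf, rfl⟩ := hS
  -- The coefficient is 1 on the zero-set, and elsewhere vanishes once `n ≥ 1 / |f x|`.
  refine ⟨⟨fun n x => max 0 (1 - n * |f x|) • (a - b) + b, fun n => by fun_prop, fun x => ?_⟩, ?_⟩
  · by_cases hx : f x = 0
    · have : twoValued (f ⁻¹' {0}) a b x = a := twoValued_of_mem hx
      simp [hx, this]
    · rw [twoValued_of_notMem (show x ∉ f ⁻¹' {0} from hx)]
      obtain ⟨m, hm⟩ := exists_nat_gt (1 / |f x|)
      refine (finite_lt_nat m).subset fun n hn => ?_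
      by_contra hmn
      refine hn ?_
      have h1 : (m : ℝ) ≤ n := by exact_mod_cast not_lt.1 hmn
      have h2 : 1 < n * |f x| := (div_lt_iff₀ (abs_pos.2 hx)).1 (hm.trans_le h1)
      simp [max_eq_left (by linarith : 1 - n * |f x| ≤ 0)]
  · have hfin : (range (twoValued (f ⁻¹' {0}) a b)).Finite := by
      refine (toFinite {a, b}).subset ?_
      rintro _ ⟨x, rfl⟩
      by_cases hx : x ∈ f ⁻¹' {0}
      · simp [twoValued_of_mem hx]
      · simp [twoValued_of_notMem hx]
    rw [hfin.isClosed.closure_eq]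
    exact hfin.isCompact

end TwoValued

/-! ### Transfinite choice and a well-order of type ω₁ -/

section Recursion

/-- Recursive choice along a well-founded relation, each choice depending on the set of the
previous ones. -/
theorem exists_recursive_choice {I T : Type*} [LT I] [WellFoundedLT I] [Nonempty T]
    (P : I → Set T → T → Prop) (h : ∀ i (v : I → T), ∃ t, P i (v '' {j | j < i}) t) :
    ∃ u : I → T, ∀ i, P i (u '' {j | j < i}) (u i) := by
  classical
  let ext (i : I) (ih : ∀ j, j < i → T) (j : I) : T :=
    if hj : j < i then ih j hj else Classical.arbitrary T
  let F (i : I) (ih : ∀ j, j < i → T) : T := (h i (ext i ih)).choose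
  let u : I → T := wellFounded_lt.fix F
  refine ⟨u, fun i => ?_⟩
  have hu : u i = F i fun j _ => u j := wellFounded_lt.fix_eq F i
  have himg : ext i (fun j _ => u j) '' {j | j < i} = u '' {j | j < i} :=
    image_congr fun j hj => dif_pos hj
  rw [hu, ← himg]
  exact (h i (ext i fun j _ => u j)).choose_spec

theorem exists_uncountable_wellOrder :
    ∃ (I : Type) (_ : LinearOrder I) (_ : WellFoundedLT I),
      (∀ i : I, {j | j < i}.Countable) ∧ ¬ Countable I := by
  refine ⟨(Cardinal.aleph 1).ord.ToType, inferInstance, inferInstance, fun i => ?_, fun h => ?_⟩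
  · rw [← Cardinal.le_aleph0_iff_set_countable, ← Order.lt_succ_iff, Cardinal.succ_aleph0]
    exact (Cardinal.mk_Iio_lt i (by simp)).trans_eq (by simp)
  · have := Cardinal.mk_le_aleph0_iff.2 h
    rw [Cardinal.mk_toType, Cardinal.card_ord] at this
    exact absurd this (not_le.2 Cardinal.aleph0_lt_aleph_one)

end Recursion

/-! ### σ-spaces and countable cs*-character -/

section SigmaSpace

variable {Z : Type*} [TopologicalSpace Z]

theorem isSigmaSpace_of_metrizableSpace [TopologicalSpace.MetrizableSpace Z] :
    IsSigmaSpace Z := by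
  let := TopologicalSpace.metrizableSpaceMetric Z
  have h : ∀ n : ℕ, ∃ t : Z → Set Z, (∀ z, IsOpen (t z)) ∧ (⋃ z, t z) = univ ∧ LocallyFinite t ∧
      ∀ z, t z ⊆ Metric.ball z (1 / (n + 1)) := fun n =>
    precise_refinement (fun z => Metric.ball z (1 / ((n : ℝ) + 1)))
      (fun _ => Metric.isOpen_ball)
      (eq_univ_of_forall fun z => mem_iUnion.2 ⟨z, Metric.mem_ball_self (by positivity)⟩)
  choose t _ ht hlf hsub using h
  refine ⟨fun n => range (t n), fun n z => ?_, fun z O hO => ?_⟩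
  · obtain ⟨O, hO, hfin⟩ := hlf n z
    refine ⟨O, hO, (hfin.image (t n)).subset ?_⟩
    rintro _ ⟨⟨y, rfl⟩, hy⟩
    exact ⟨y, hy, rfl⟩
  · obtain ⟨ε, hε, hball⟩ := Metric.mem_nhds_iff.1 hO
    obtain ⟨n, hn⟩ := exists_nat_one_div_lt (half_pos hε)
    obtain ⟨y, hy⟩ := mem_iUnion.1 ((ht n).symm ▸ mem_univ z : z ∈ ⋃ y, t n y)
    refine ⟨t n y, mem_iUnion.2 ⟨n, y, rfl⟩, hy, fun w hw => hball ?_⟩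
    have h1 := Metric.mem_ball.1 (hsub n y hy)
    have h2 := Metric.mem_ball.1 (hsub n y hw)
    have h3 := dist_triangle_right w z y
    exact Metric.mem_ball.2 (by linarith)

theorem hasCountableCsStarCharacter_of_firstCountable [FirstCountableTopology Z] :
    HasCountableCsStarCharacter Z := by
  intro z
  obtain ⟨B, hB⟩ := (𝓝 z).exists_antitone_basis
  refine ⟨range B, countable_range B, fun u hu O hO => ?_⟩
  obtain ⟨n, -, hn⟩ := hB.1.mem_iff.1 hO
  refine ⟨B n, ⟨n, rfl⟩, mem_of_mem_nhds (hB.mem n), hn, ?_⟩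
  exact Nat.frequently_atTop_iff_infinite.1 (hu.eventually (hB.mem n)).frequently

/-- At level `n`, remove the closures of the members of `𝒩 n` that do not have `z` in their closure;
local finiteness makes their union closed. By regularity every `y ≠ z` is removed at some level. -/
theorem IsSigmaSpace.exists_nhds_iInter_eq [T3Space Z] (h : IsSigmaSpace Z) (z : Z) :
    ∃ O : ℕ → Set Z, (∀ n, O n ∈ 𝓝 z) ∧ ⋂ n, O n ⊆ {z} := by
  obtain ⟨𝒩, hlf, hnet⟩ := h
  refine ⟨fun n => (⋃ N : {N ∈ 𝒩 n | z ∉ closure N}, closure (N : Set Z))ᶜ, fun n => ?_,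
    fun y hy => ?_⟩
  · refine IsClosed.compl_mem_nhds ?_ ?_
    · refine LocallyFinite.isClosed_iUnion (LocallyFinite.closure fun y => ?_)
        fun _ => isClosed_closure
      obtain ⟨O, hO, hfin⟩ := hlf n y
      exact ⟨O, hO, Finite.of_finite_image (hfin.subset (by
        rintro _ ⟨N, hN, rfl⟩
        exact ⟨N.2.1, hN⟩)) Subtype.val_injective.injOn⟩
    · intro hz
      obtain ⟨N, hN⟩ := mem_iUnion.1 hz
      exact N.2.2 hN
  · by_contra hyz
    obtain ⟨O, hO, hOc, hsub⟩ := exists_mem_nhds_isClosed_subset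
      (isOpen_compl_singleton.mem_nhds (show y ∈ ({z}ᶜ : Set Z) from hyz))
    obtain ⟨N, hN, hyN, hNO⟩ := hnet y O hO
    obtain ⟨n, hn⟩ := mem_iUnion.1 hN
    refine mem_iInter.1 hy n (mem_iUnion.2 ⟨⟨N, hn, fun hz => ?_⟩, subset_closure hyN⟩)
    exact hsub (closure_minimal hNO hOc hz) rfl

end SigmaSpace

theorem exists_injective_choice {X : Type*} {B : ℕ → Set X} (hB : ∀ n, (B n).Infinite) :
    ∃ a : ℕ → X, Function.Injective a ∧ ∀ n, a n ∈ B n := by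
  have : Nonempty X := (hB 0).nonempty.to_type
  obtain ⟨a, ha⟩ := exists_recursive_choice (fun n (S : Set X) t => t ∈ B n ∧ t ∉ S)
    fun n v => (hB n).exists_notMem_finite ((finite_lt_nat n).image v)
  refine ⟨a, ?_, fun n => (ha n).1⟩
  intro m n h
  rcases lt_trichotomy m n with hmn | hmn | hmn
  · exact absurd ⟨m, hmn, h⟩ (ha n).2
  · exact hmn
  · exact absurd ⟨n, hmn, h.symm⟩ (ha m).2

/-! ### The implications of (A) -/

section FunctionSpace

variable {X E : Type*} [TopologicalSpace E] {H : Set (X → E)}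

theorem continuous_eval (x : X) : Continuous fun h : H => (h : X → E) x :=
  (continuous_apply x).comp continuous_subtype_val

theorem exists_finite_of_mem_nhds {g : H} {W : Set H} (hW : W ∈ 𝓝 g) :
    ∃ F : Set X, F.Finite ∧ ∃ O : X → Set E, (∀ x, O x ∈ 𝓝 ((g : X → E) x)) ∧
      ∀ h : H, (∀ x ∈ F, (h : X → E) x ∈ O x) → h ∈ W := by
  obtain ⟨V, hV, hVW⟩ := mem_nhds_subtype H g W |>.1 hW
  rw [nhds_pi, Filter.mem_pi] at hV
  obtain ⟨F, hF, O, hO, hsub⟩ := hV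
  exact ⟨F, hF, O, hO, fun h hh => hVW (hsub hh)⟩

theorem mem_closure_of_forall_finite_eqOn {A : Set H} {g : H}
    (h : ∀ F : Set X, F.Finite → ∃ a ∈ A, ∀ x ∈ F, (a : X → E) x = (g : X → E) x) :
    g ∈ closure A := by
  refine mem_closure_iff_nhds.2 fun W hW => ?_
  obtain ⟨F, hF, O, hO, hsub⟩ := exists_finite_of_mem_nhds hW
  obtain ⟨a, ha, hag⟩ := h F hF
  exact ⟨a, hsub a fun x hx => hag x hx ▸ mem_of_mem_nhds (hO x), ha⟩

theorem tendsto_of_eval {ι : Type*} {l : Filter ι} {u : ι → H} {g : H}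
    (h : ∀ x, Tendsto (fun i => (u i : X → E) x) l (𝓝 ((g : X → E) x))) : Tendsto u l (𝓝 g) :=
  tendsto_subtype_rng.2 (tendsto_pi_nhds.2 h)

theorem metrizableSpace_pi_of_countable [TopologicalSpace.MetrizableSpace E] [Countable X] :
    TopologicalSpace.MetrizableSpace (X → E) := by
  let := TopologicalSpace.metrizableSpaceMetric E
  exact UniformSpace.metrizableSpace

theorem metrizableSpace_of_countable [TopologicalSpace.MetrizableSpace E] [Countable X] :
    TopologicalSpace.MetrizableSpace H :=
  have := metrizableSpace_pi_of_countable (X := X) (E := E)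
  TopologicalSpace.MetrizableSpace.subtype H

variable [TopologicalSpace X] [T35Space X]

/-- The constant function `b` is isolated by countably many neighbourhoods, which involve only
countably many coordinates. A point outside these coordinates would give a second function in all
the neighbourhoods. -/
theorem countable_of_isSigmaSpace [T3Space E] {a b : E} (hab : a ≠ b)
    (hH : ∀ S ∈ zeroSets X, twoValued S a b ∈ H) (h : IsSigmaSpace H) : Countable X := by
  -- The empty union is the empty zero-set, so `g` is constantly `b`.
  let g : H := ⟨_, hH _ (biUnion_mem_zeroSets (finite_empty (α := X)) (S := fun _ => ∅) (by simp))⟩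
  have hg : ∀ x, (g : X → E) x = b := fun x => twoValued_of_notMem (by simp)
  obtain ⟨O, hO, hOg⟩ := h.exists_nhds_iInter_eq g
  choose F hF V hV hsub using fun n => exists_finite_of_mem_nhds (hO n)
  have hD : (⋃ n, F n).Countable := countable_iUnion fun n => (hF n).countable
  refine countable_univ_iff.1 (hD.mono fun x _ => ?_)
  by_contra hx
  obtain ⟨S, hS, hxS, hSD⟩ := exists_zeroSet_disjoint hD hx
  have hmem : (⟨_, hH S hS⟩ : H) ∈ ⋂ n, O n := by
    refine mem_iInter.2 fun n => hsub n _ fun y hy => ?_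
    have : twoValued S a b y = b := twoValued_of_notMem fun hyS => hSD y hyS (mem_iUnion.2 ⟨n, hy⟩)
    change twoValued S a b y ∈ V n y
    rw [this, ← hg y]
    exact mem_of_mem_nhds (hV n y)
  have heq := congrArg (fun f : H => (f : X → E) x) (hOg hmem)
  simp only [hg, twoValued_of_mem hxS] at heq
  exact hab heq

/-- A diagonal argument: if `x` lies in no finite `A N`, one sequence converging to `g` eventually
leaves every `N` with `A N` infinite, while some such `N` must contain infinitely many of its terms.
-/
theorem countable_of_hasCountableCsStarCharacter [T1Space E] {a b : E} (hab : a ≠ b)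
    (hH : ∀ S ∈ zeroSets X, twoValued S a b ∈ H) (h : HasCountableCsStarCharacter H) :
    Countable X := by
  let g : H := ⟨_, hH _ (biUnion_mem_zeroSets (finite_empty (α := X)) (S := fun _ => ∅) (by simp))⟩
  have hg : ∀ x, (g : X → E) x = b := fun x => twoValued_of_notMem (by simp)
  obtain ⟨𝒩, h𝒩c, h𝒩⟩ := h g
  let A (N : Set H) : Set X := {x | ∀ f ∈ N, (f : X → E) x ≠ a}
  have hO : ∀ x, {f : H | (f : X → E) x ≠ a} ∈ 𝓝 g := fun x =>
    (continuous_eval x).continuousAt.eventually_ne (by rw [hg]; exact hab.symm)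
  have hcov : ∀ x, ∀ u : ℕ → H, Tendsto u atTop (𝓝 g) →
      ∃ N ∈ 𝒩, x ∈ A N ∧ {n | u n ∈ N}.Infinite := by
    intro x u hu
    obtain ⟨N, hN, -, hNO, hinf⟩ := h𝒩 u hu _ (hO x)
    exact ⟨N, hN, fun f hf => hNO hf, hinf⟩
  have hC : (⋃ N ∈ {N ∈ 𝒩 | (A N).Finite}, A N).Countable :=
    (h𝒩c.mono (sep_subset _ _)).biUnion fun N hN => hN.2.countable
  refine countable_univ_iff.1 (hC.mono fun x _ => ?_)
  by_contra hx
  have hinfA : ∀ N ∈ 𝒩, x ∈ A N → (A N).Infinite := fun N hN hxN hfin =>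
    hx (mem_biUnion (show N ∈ {N ∈ 𝒩 | (A N).Finite} from ⟨hN, hfin⟩) hxN)
  obtain ⟨N₀, hN₀, hxN₀, -⟩ := hcov x _ tendsto_const_nhds
  obtain ⟨N, hN⟩ := (h𝒩c.mono (sep_subset _ fun N => (A N).Infinite)).exists_eq_range
    ⟨N₀, hN₀, hinfA N₀ hN₀ hxN₀⟩
  -- Coding indices by pairs gives each `A (N k)` infinitely many distinct points `p (pair k n)`,
  -- one for each `n`.
  obtain ⟨p, hpinj, hp⟩ := exists_injective_choice (B := fun i => A (N i.unpair.1)) fun i =>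
    (hN.symm ▸ mem_range_self _ : N i.unpair.1 ∈ {N ∈ 𝒩 | (A N).Infinite}).2
  obtain ⟨Φ, hΦ, hΦinj⟩ := exists_continuous_injOn (range p)
  have hΦp : ∀ i j, Φ (p i) = Φ (p j) → i = j := fun i j hij =>
    hpinj (hΦinj _ ⟨i, rfl⟩ _ ⟨j, rfl⟩ hij)
  -- These sets are pairwise disjoint, so their two-valued functions converge to `g`; the `n`-th one
  -- takes the value `a` in `A (N k)` for every `k ≤ n`, hence is not in `N k`.
  let S (n : ℕ) : Set X := ⋃ k ∈ Iic n, Φ ⁻¹' {Φ (p (Nat.pair k n))}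
  have := (countable_range p).to_subtype
  have hS : ∀ n, S n ∈ zeroSets X := fun n =>
    biUnion_mem_zeroSets (finite_Iic n) fun k _ => fiber_mem_zeroSets hΦ _
  have hmemS : ∀ n y, y ∈ S n → ∃ k ≤ n, Φ y = Φ (p (Nat.pair k n)) := by
    intro n y hy
    obtain ⟨k, hk, hyk⟩ := mem_iUnion₂.1 hy
    exact ⟨k, hk, hyk⟩
  let u (n : ℕ) : H := ⟨_, hH _ (hS n)⟩
  have hu : Tendsto u atTop (𝓝 g) := by
    refine tendsto_of_eval fun y => ?_
    have hev : ∀ᶠ n in atTop, y ∉ S n := by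
      by_cases hy : ∃ n, y ∈ S n
      · obtain ⟨n, hn⟩ := hy
        filter_upwards [eventually_gt_atTop n] with m hm hym
        obtain ⟨k, _, hk⟩ := hmemS n y hn
        obtain ⟨l, _, hl⟩ := hmemS m y hym
        have := (Nat.pair_eq_pair.1 (hΦp _ _ (hk.symm.trans hl))).2
        omega
      · exact Eventually.of_forall fun n hn => hy ⟨n, hn⟩
    rw [hg]
    refine tendsto_const_nhds.congr' ?_
    filter_upwards [hev] with n hn
    exact (twoValued_of_notMem hn).symm
  obtain ⟨N', hN', hxN', hinf⟩ := hcov x u hu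
  obtain ⟨k, rfl⟩ : N' ∈ range N := hN ▸ ⟨hN', hinfA N' hN' hxN'⟩
  obtain ⟨n, hn, hkn⟩ := hinf.exists_gt k
  have hpA := hp (Nat.pair k n)
  simp only [Nat.unpair_pair] at hpA
  refine hpA (u n) hn (twoValued_of_mem ?_)
  exact mem_biUnion (show k ∈ Iic n from hkn.le) rfl

end FunctionSpace

/-! ### ω-covers by zero-sets and property γ -/

section OmegaCovers

variable (X : Type*) [TopologicalSpace X]

/-- Every `ω`-cover by zero-sets has a countable `ω`-subcover. -/
def HasCountableOmegaSubcovers : Prop :=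
  ∀ 𝒱 ⊆ zeroSets X, IsOmegaCover 𝒱 → ∃ 𝒱' ⊆ 𝒱, 𝒱'.Countable ∧ IsOmegaCover 𝒱'

/-- The Baire topology is Lindelöf, in terms of neighbourhood assignments by zero-sets. -/
def IsBaireLindelof : Prop :=
  ∀ O : X → Set X, (∀ x, O x ∈ zeroSets X) → (∀ x, x ∈ O x) →
    ∃ C : Set X, C.Countable ∧ ∀ y, ∃ x ∈ C, y ∈ O x

variable {X}

/-- The Lindelöf property for `n`-tuples. Fixing a first entry `x`, induction gives a countable
family of sets containing `x`; its intersection is a zero-set around `x`, and every first entry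
taken from it is served by the same family. -/
theorem IsBaireLindelof.exists_countable_subfamily (hL : IsBaireLindelof X) (n : ℕ)
    {𝒱 : Set (Set X)} (h𝒱 : 𝒱 ⊆ zeroSets X)
    (hcov : ∀ l : List X, l.length = n → ∃ V ∈ 𝒱, ∀ x ∈ l, x ∈ V) :
    ∃ 𝒱' ⊆ 𝒱, 𝒱'.Countable ∧ ∀ l : List X, l.length = n → ∃ V ∈ 𝒱', ∀ x ∈ l, x ∈ V := by
  induction n generalizing 𝒱 with
  | zero =>
    obtain ⟨V, hV, -⟩ := hcov [] rfl
    refine ⟨{V}, singleton_subset_iff.2 hV, countable_singleton V, fun l hl => ⟨V, rfl, ?_⟩⟩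
    simp [List.length_eq_zero_iff.1 hl]
  | succ n ih =>
    have h : ∀ x, ∃ 𝒱' ⊆ {V ∈ 𝒱 | x ∈ V}, 𝒱'.Countable ∧
        ∀ l : List X, l.length = n → ∃ V ∈ 𝒱', ∀ y ∈ l, y ∈ V := by
      refine fun x => ih ((sep_subset _ _).trans h𝒱) fun l hl => ?_
      obtain ⟨V, hV, hlV⟩ := hcov (x :: l) (by simp [hl])
      exact ⟨V, ⟨hV, hlV x (by simp)⟩, fun y hy => hlV y (by simp [hy])⟩
    choose 𝒲 hsub hcount h𝒲 using h
    obtain ⟨C, hC, hCcov⟩ := hL (fun x => ⋂ V ∈ 𝒲 x, V)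
      (fun x => biInter_mem_zeroSets (hcount x) fun V hV => h𝒱 (hsub x hV).1)
      (fun x => mem_iInter₂.2 fun V hV => (hsub x hV).2)
    refine ⟨⋃ x ∈ C, 𝒲 x, iUnion₂_subset fun x _ V hV => (hsub x hV).1,
      hC.biUnion fun x _ => hcount x, fun l hl => ?_⟩
    obtain ⟨y, l, rfl⟩ := List.exists_cons_of_length_eq_add_one hl
    obtain ⟨x, hx, hyx⟩ := hCcov y
    obtain ⟨V, hV, hlV⟩ := h𝒲 x l (by simpa using hl)
    refine ⟨V, mem_biUnion hx hV, fun z hz => ?_⟩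
    rcases List.mem_cons.1 hz with rfl | hz
    · exact mem_iInter₂.1 hyx V hV
    · exact hlV z hz

theorem IsBaireLindelof.hasCountableOmegaSubcovers (hL : IsBaireLindelof X) :
    HasCountableOmegaSubcovers X := by
  intro 𝒱 h𝒱 hcov
  choose 𝒲 hsub hcount h𝒲 using fun n => hL.exists_countable_subfamily n h𝒱 fun l _ =>
    hcov {x | x ∈ l} l.finite_toSet
  refine ⟨⋃ n, 𝒲 n, iUnion_subset hsub, countable_iUnion hcount, fun F hF => ?_⟩
  obtain ⟨V, hV, hFV⟩ := h𝒲 _ hF.toFinset.toList rfl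
  exact ⟨V, mem_iUnion.2 ⟨_, hV⟩, fun x hx => hFV x (by simpa using hx)⟩

/-- The hypothesis is used twice: to replace the cover by a countable zero-set cover, and to show
that the map `Φ` defining its members has countable image. Members are saturated for `Φ`, so it
suffices to capture an enumerated set of representatives. -/
theorem HasCountableOmegaSubcovers.hasPropertyGamma (h : HasCountableOmegaSubcovers X) :
    @HasPropertyGamma X (baireTopology X) := by
  intro 𝒰 h𝒰 hcov
  obtain ⟨𝒱, h𝒱, h𝒱c, h𝒱cov⟩ := h {V ∈ zeroSets X | ∃ U ∈ 𝒰, V ⊆ U} (sep_subset _ _) (by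
    intro F hF
    obtain ⟨U, hU, hFU⟩ := hcov F hF
    have hS : ∀ x ∈ F, ∃ S ∈ zeroSets X, x ∈ S ∧ S ⊆ U := fun x hx =>
      isOpen_baireTopology_iff.1 (h𝒰 U hU) x (hFU hx)
    choose! S hS hxS hSU using hS
    exact ⟨⋃ x ∈ F, S x, ⟨biUnion_mem_zeroSets hF hS, U, hU, iUnion₂_subset hSU⟩,
      fun x hx => mem_biUnion hx (hxS x hx)⟩)
  have := h𝒱c.to_subtype
  choose φ hφ hφV using fun V : 𝒱 => (h𝒱 V.2).1
  let Φ (x : X) (V : 𝒱) : ℝ := φ V x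
  have hΦ : Continuous Φ := continuous_pi hφ
  have hΦV : ∀ V ∈ 𝒱, ∀ x y, Φ x = Φ y → x ∈ V → y ∈ V := by
    intro V hV x y hxy hx
    have hVe := hφV ⟨V, hV⟩
    have h1 : φ ⟨V, hV⟩ x = φ ⟨V, hV⟩ y := congrFun hxy ⟨V, hV⟩
    simp only at hVe
    rw [hVe] at hx ⊢
    exact h1.symm.trans hx
  -- Finite unions of fibres form an ω-cover by zero-sets; a countable subcover involves only
  -- countably many fibres.
  obtain ⟨𝒬, h𝒬, h𝒬c, h𝒬cov⟩ := h {P | ∃ F : Set X, F.Finite ∧ P = ⋃ x ∈ F, Φ ⁻¹' {Φ x}}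
    (by
      rintro _ ⟨F, hF, rfl⟩
      exact biUnion_mem_zeroSets hF fun x _ => fiber_mem_zeroSets hΦ _)
    fun F hF => ⟨_, ⟨F, hF, rfl⟩, fun x hx => mem_biUnion hx rfl⟩
  choose! F hF hPF using fun P (hP : P ∈ 𝒬) => h𝒬 hP
  have hC : (⋃ P ∈ 𝒬, F P).Countable := h𝒬c.biUnion fun P hP => (hF P hP).countable
  have hCcov : ∀ x, ∃ c ∈ ⋃ P ∈ 𝒬, F P, Φ x = Φ c := by
    intro x
    obtain ⟨P, hP, hxP⟩ := h𝒬cov {x} (finite_singleton x)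
    rw [hPF P hP] at hxP
    obtain ⟨c, hc, hxc⟩ := mem_iUnion₂.1 (hxP rfl)
    exact ⟨c, mem_biUnion hP hc, hxc⟩
  rcases isEmpty_or_nonempty X with hX | ⟨⟨x₀⟩⟩
  · obtain ⟨U, hU, -⟩ := hcov ∅ finite_empty
    exact ⟨fun _ => U, fun _ => hU, fun z => (hX.false z).elim⟩
  obtain ⟨c₀, hc₀, -⟩ := hCcov x₀
  obtain ⟨c, hc⟩ := hC.exists_eq_range ⟨c₀, hc₀⟩
  choose V hV hcV using fun n : ℕ => h𝒱cov (c '' Iic n) ((finite_Iic n).image c)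
  choose U hU hVU using fun n => (h𝒱 (hV n)).2
  refine ⟨U, hU, fun z => ?_⟩
  obtain ⟨d, hd, hzd⟩ := hCcov z
  obtain ⟨i, rfl⟩ := hc ▸ hd
  filter_upwards [eventually_ge_atTop i] with n hn
  exact hVU n (hΦV _ (hV n) _ _ hzd.symm (hcV n ⟨i, hn, rfl⟩))

end OmegaCovers

/-! ### Tightness, k-spaces and cluster points -/

section Topology

variable {Z : Type*} [TopologicalSpace Z]

theorem hasCountableTightness_of_frechetUrysohnSpace [FrechetUrysohnSpace Z] :
    HasCountableTightness Z := by
  intro A z hz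
  obtain ⟨u, hu, hlim⟩ := mem_closure_iff_seq_limit.1 hz
  exact ⟨range u, range_subset_iff.2 hu, countable_range u,
    mem_closure_of_tendsto hlim (Eventually.of_forall mem_range_self)⟩

theorem exists_isCompact_of_not_isClosed [CompactlyCoherentSpace Z] {A : Set Z}
    (hA : ¬ IsClosed A) : ∃ K, IsCompact K ∧ ∃ z ∈ K, z ∈ closure (K ∩ A) ∧ z ∉ A := by
  rw [CompactlyCoherentSpace.isClosed_iff] at hA
  push Not at hA
  obtain ⟨K, hK, hKA⟩ := hA
  rw [isClosed_preimage_val, not_subset] at hKA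
  obtain ⟨z, ⟨hzK, hz⟩, hzA⟩ := hKA
  exact ⟨K, hK, z, hzK, hz, hzA⟩

theorem eq_of_mapClusterPt_of_tendsto [T2Space Z] {ι : Type*} {l : Filter ι} {u : ι → Z} {y z : Z}
    (hy : MapClusterPt y l u) (hz : Tendsto u l (𝓝 z)) : y = z := by
  have : (𝓝 y ⊓ 𝓝 z).NeBot := NeBot.mono hy (inf_le_inf_left _ hz)
  exact eq_of_nhds_neBot this

end Topology

/-! ### The implications of (B) -/

section FunctionSpace

variable {X E : Type*} [TopologicalSpace E] {H : Set (X → E)}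

theorem eval_eq_of_mapClusterPt [T2Space E] {ι : Type*} {l : Filter ι} {u : ι → H} {f : H}
    (hf : MapClusterPt f l u) {x : X} {c : E}
    (hx : Tendsto (fun i => (u i : X → E) x) l (𝓝 c)) : (f : X → E) x = c :=
  eq_of_mapClusterPt_of_tendsto 
    (hf.continuousAt_comp (f := fun h : H => (h : X → E) x) (continuous_eval x).continuousAt) hx

/-- Restriction to `D` lands in a metrizable space, so a sequence in the set converges to `g` on
`D`. A cluster point in `K` agrees with `g` there, and differs from `b` only where some term does.
-/
theorem exists_mem_eqOn_of_mem_closure [TopologicalSpace.MetrizableSpace E] {b : E}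
    {O : X → Set X} {K : Set H} (hK : IsCompact K) {g : H}
    (hg : g ∈ closure (K ∩ {f : H | ∃ C : Set X, C.Countable ∧
      ∀ x, (f : X → E) x ≠ b → ∃ c ∈ C, x ∈ O c}))
    {D : Set X} (hD : D.Countable) :
    ∃ f ∈ K ∩ {f : H | ∃ C : Set X, C.Countable ∧ ∀ x, (f : X → E) x ≠ b → ∃ c ∈ C, x ∈ O c},
      ∀ x ∈ D, (f : X → E) x = (g : X → E) x := by
  have := hD.to_subtype
  have := metrizableSpace_pi_of_countable (X := D) (E := E)
  have hρ : Continuous fun (f : H) (x : D) => (f : X → E) x :=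
    continuous_pi fun x => continuous_eval (x : X)
  obtain ⟨v, hv, hlim⟩ := mem_closure_iff_seq_limit.1
    (image_closure_subset_closure_image hρ (mem_image_of_mem _ hg))
  choose u hu huv using hv
  choose C hC hCu using fun n => (hu n).2
  obtain ⟨f, hfK, hf⟩ := hK.exists_mapClusterPt (f := atTop) (u := u)
    (tendsto_principal.2 (Eventually.of_forall fun n => (hu n).1))
  refine ⟨f, ⟨hfK, ⋃ n, C n, countable_iUnion hC, fun x hx => ?_⟩, fun x hx => ?_⟩
  · by_contra! hcon
    refine hx (eval_eq_of_mapClusterPt hf (tendsto_const_nhds.congr fun n => ?_))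
    by_contra hne
    obtain ⟨c, hc, hxc⟩ := hCu n x (Ne.symm hne)
    exact hcon c (mem_iUnion.2 ⟨n, hc⟩) hxc
  · refine eval_eq_of_mapClusterPt hf ?_
    refine (tendsto_pi_nhds.1 hlim ⟨x, hx⟩).congr fun n => ?_
    rw [← huv n]

variable [TopologicalSpace X]

theorem hasCountableOmegaSubcovers_of_hasCountableTightness [T1Space E] {a b : E} (hab : a ≠ b)
    (hH : ∀ S ∈ zeroSets X, twoValued S a b ∈ H) (h : HasCountableTightness H) :
    HasCountableOmegaSubcovers X := by
  intro 𝒱 h𝒱 hcov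
  let g : H := ⟨_, hH _ univ_mem_zeroSets⟩
  have hg : ∀ x, (g : X → E) x = a := fun x => twoValued_of_mem (mem_univ x)
  obtain ⟨B, hBA, hB, hgB⟩ := h {f | ∃ V ∈ 𝒱, (f : X → E) = twoValued V a b} g
    (mem_closure_of_forall_finite_eqOn fun F hF => by
      obtain ⟨V, hV, hFV⟩ := hcov F hF
      exact ⟨⟨_, hH V (h𝒱 hV)⟩, ⟨V, hV, rfl⟩, fun x hx =>
        (twoValued_of_mem (hFV hx)).trans (hg x).symm⟩)
  choose! V hV hVeq using fun f (hf : f ∈ B) => hBA hf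
  refine ⟨V '' B, image_subset_iff.2 hV, hB.image V, fun F hF => ?_⟩
  have hW : ∀ᶠ f : H in 𝓝 g, ∀ x ∈ F, (f : X → E) x ≠ b := by
    rw [eventually_all_finite hF]
    exact fun x _ => (continuous_eval x).continuousAt.eventually_ne (by rw [hg]; exact hab)
  obtain ⟨f, hfF, hfB⟩ := mem_closure_iff_nhds.1 hgB _ hW
  refine ⟨V f, mem_image_of_mem V hfB, fun x hx => ?_⟩
  by_contra hxV
  refine hfF x hx ?_
  rw [hVeq f hfB, twoValued_of_notMem hxV]

theorem frechetUrysohnSpace_of_hasPropertyGamma [T35Space X] [TopologicalSpace.MetrizableSpace E]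
    (hloc : ∀ f ∈ H, IsZeroSetLocallyConstant f)
    (hγ : @HasPropertyGamma X (baireTopology X)) : FrechetUrysohnSpace H := by
  rcases finite_or_infinite X with hX | hX
  · have := metrizableSpace_of_countable (H := H)
    infer_instance
  let := TopologicalSpace.metrizableSpaceMetric E
  let p := Infinite.natEmbedding X
  refine ⟨fun A g hg => ?_⟩
  let U (n : ℕ) (f : H) : Set X :=
    -- Omitting `p n` forces the precision to improve: along a γ-sequence each index `n` can occur
    -- only finitely often, since `p n` lies in almost all terms.
    {x | dist ((f : X → E) x) ((g : X → E) x) < 1 / ((n : ℝ) + 1) ∧ x ≠ p n}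
  obtain ⟨W, hW, hWev⟩ := hγ {V | ∃ n, ∃ f ∈ A, V = U n f} (by
      rintro _ ⟨n, f, hf, rfl⟩
      refine isOpen_baireTopology_iff.2 fun x hx => ?_
      obtain ⟨S, hS, hxS, hSf⟩ := hloc f f.2 x
      obtain ⟨T, hT, hxT, hTg⟩ := hloc g g.2 x
      obtain ⟨R, hR, hxR, hRp⟩ := exists_zeroSet_disjoint (countable_singleton (p n)) hx.2
      refine ⟨_, inter_mem_zeroSets (inter_mem_zeroSets hS hT) hR, ⟨⟨hxS, hxT⟩, hxR⟩,
        fun y hy => ⟨?_, hRp y hy.2⟩⟩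
      rw [hSf y hy.1.1, hTg y hy.1.2]
      exact hx.1)
    (by
      intro F hF
      obtain ⟨_, ⟨n, rfl⟩, hn⟩ := (infinite_range_of_injective p.injective).exists_notMem_finite hF
      have hev : ∀ᶠ f : H in 𝓝 g, ∀ x ∈ F,
          dist ((f : X → E) x) ((g : X → E) x) < 1 / ((n : ℝ) + 1) := by
        rw [eventually_all_finite hF]
        exact fun x _ => (continuous_eval x).continuousAt.eventually
          (Metric.ball_mem_nhds _ (by positivity))
      obtain ⟨f, hfF, hfA⟩ := mem_closure_iff_nhds.1 hg _ hev
      exact ⟨_, ⟨n, f, hfA, rfl⟩, fun x hx => ⟨hfF x hx, fun h => hn (h ▸ hx)⟩⟩)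
  choose n f hf hWU using hW
  refine ⟨f, hf, tendsto_of_eval fun x => Metric.tendsto_atTop'.2 fun ε hε => ?_⟩
  obtain ⟨N, hN⟩ := exists_nat_one_div_lt hε
  have hlarge : ∀ᶠ k in atTop, ∀ m ∈ {m | m < N}, n k ≠ m := by
    rw [eventually_all_finite (finite_lt_nat N)]
    intro m _
    filter_upwards [hWev (p m)] with k hk hkm
    rw [hWU, hkm] at hk
    exact hk.2 rfl
  obtain ⟨k₀, hk₀⟩ := eventually_atTop.1 (hlarge.and (hWev x))
  refine ⟨k₀, fun k hk => ?_⟩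
  obtain ⟨h1, h2⟩ := hk₀ k hk.le
  have h3 : N ≤ n k := not_lt.1 fun h => h1 _ h rfl
  rw [hWU] at h2
  exact h2.1.trans_le ((Nat.one_div_le_one_div h3).trans hN.le)

/-- The zero function is a limit of the closed sets `A n`, whose members are large at all but
finitely many points of `D`. The k-property gives a compact set meeting `A n` for arbitrarily large
`n`; being bounded at each point, it exhausts `D` by countably many finite sets. -/
theorem countable_of_forall_exists_zeroSet [T35Space X] [AddCommGroup E] [Module ℝ E]
    [ContinuousSMul ℝ E] [CompactlyCoherentSpace H]
    (hH : ∀ S ∈ zeroSets X, ∀ a b : E, twoValued S a b ∈ H) {p : E →L[ℝ] ℝ} {e : E} (hpe : p e = 1)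
    {D : Set X} (hD : ∀ x, ∃ U ∈ zeroSets X, x ∈ U ∧ (U ∩ D).Countable) : D.Countable := by
  rcases D.eq_empty_or_nonempty with rfl | ⟨x₀, -⟩
  · exact countable_empty
  have hD' : ∀ x, ∃ U ∈ zeroSets X, x ∈ U ∧ U ∩ D ⊆ {x} := by
    intro x
    obtain ⟨U, hU, hxU, hUD⟩ := hD x
    obtain ⟨S, hS, hxS, hSD⟩ := exists_zeroSet_disjoint (hUD.mono (sdiff_subset (t := {x})))
      (fun h : x ∈ (U ∩ D) \ {x} => h.2 rfl)
    refine ⟨_, inter_mem_zeroSets hU hS, ⟨hxU, hxS⟩, fun y hy => ?_⟩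
    by_contra hyx
    exact hSD y hy.1.2 ⟨⟨hy.1.1, hy.2⟩, hyx⟩
  choose U hU hxU hUD using hD'
  have hcont : ∀ x, Continuous fun f : H => p ((f : X → E) x) := fun x =>
    p.continuous.comp (continuous_eval x)
  -- At most `n` points of `D` satisfy `p (f x) < n`. The condition at `x₀` keeps the zero function
  -- out, even for `n = 0`.
  let A (n : ℕ) : Set H := {f | 1 / ((n : ℝ) + 1) ≤ p ((f : X → E) x₀)} ∩
    ⋂ t ∈ {t : Finset X | ↑t ⊆ D ∧ n < t.card}, ⋃ x ∈ t, {f : H | (n : ℝ) ≤ p ((f : X → E) x)}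
  have hAclosed : ∀ n, IsClosed (A n) := fun n =>
    (isClosed_le continuous_const (hcont x₀)).inter (isClosed_biInter fun t _ =>
      isClosed_biUnion_finset fun x _ => isClosed_le continuous_const (hcont x))
  have hAfin : ∀ n, ∀ f ∈ A n, {x ∈ D | p ((f : X → E) x) < n}.Finite := by
    intro n f hf
    by_contra hinf
    obtain ⟨t, ht, htn⟩ := Set.Infinite.exists_subset_card_eq hinf (n + 1)
    obtain ⟨x, hx, hfx⟩ := mem_iUnion₂.1 (mem_iInter₂.1 hf.2 t
      ⟨ht.trans (sep_subset _ _), by omega⟩)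
    exact (ht hx).2.not_ge hfx
  let g : H := ⟨_, hH _ univ_mem_zeroSets 0 0⟩
  have hg : ∀ x, (g : X → E) x = 0 := fun x => twoValued_of_mem (mem_univ x)
  have hgA : g ∉ ⋃ n, A n := by
    intro hgA
    obtain ⟨n, hn, -⟩ := mem_iUnion.1 hgA
    have hn' : 1 / ((n : ℝ) + 1) ≤ 0 := by simpa [hg] using hn
    exact hn'.not_gt (by positivity)
  have hgcl : g ∈ closure (⋃ n, A n) := by
    refine mem_closure_iff_nhds.2 fun W hW => ?_
    obtain ⟨F, hF, O, hO, hsub⟩ := exists_finite_of_mem_nhds hW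
    have hlim : Tendsto (fun n : ℕ => (1 / ((n : ℝ) + 1)) • e) atTop (𝓝 0) := by
      simpa using (tendsto_one_div_add_atTop_nhds_zero_nat (𝕜 := ℝ)).smul_const e
    have hev : ∀ᶠ n : ℕ in atTop, ∀ x ∈ F, (1 / ((n : ℝ) + 1)) • e ∈ O x := by
      rw [eventually_all_finite hF]
      exact fun x _ => hlim (by simpa [hg] using hO x)
    obtain ⟨n, hn, hnF⟩ := (hev.and (eventually_ge_atTop hF.toFinset.card)).exists
    have hFU : ∀ x ∈ F, x ∈ ⋃ x ∈ F, U x := fun x hx => mem_biUnion hx (hxU x)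
    -- Small near `F` and large elsewhere; the union meets `D` only inside `F`, which has at most
    -- `n` points.
    let f : H := ⟨_, hH (⋃ x ∈ F, U x) (biUnion_mem_zeroSets hF fun x _ => hU x)
      ((1 / ((n : ℝ) + 1)) • e) (((n : ℝ) + 1) • e)⟩
    have hf1 : ∀ x ∈ ⋃ x ∈ F, U x, (f : X → E) x = (1 / ((n : ℝ) + 1)) • e := fun x hx =>
      twoValued_of_mem hx
    have hf2 : ∀ x ∉ ⋃ x ∈ F, U x, (f : X → E) x = ((n : ℝ) + 1) • e := fun x hx =>
      twoValued_of_notMem hx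
    refine ⟨f, hsub f fun x hx => ?_, mem_iUnion.2 ⟨n, ?_, mem_iInter₂.2 fun t ht => ?_⟩⟩
    · rw [hf1 x (hFU x hx)]
      exact hn x hx
    · by_cases hx : x₀ ∈ ⋃ x ∈ F, U x
      · simp [hf1 x₀ hx, hpe]
      · have h1 : 1 / ((n : ℝ) + 1) ≤ 1 := by
          rw [div_le_one (by positivity)]
          linarith [(Nat.cast_nonneg n : (0 : ℝ) ≤ n)]
        have h2 : (0 : ℝ) ≤ n := Nat.cast_nonneg n
        simp only [mem_ofPred_eq, hf2 x₀ hx, map_smul, hpe, smul_eq_mul, mul_one]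
        linarith
    · obtain ⟨y, hy, hyF⟩ := Finset.exists_mem_notMem_of_card_lt_card (hnF.trans_lt ht.2)
      refine mem_biUnion hy ?_
      have hyU : y ∉ ⋃ x ∈ F, U x := by
        intro hyU
        obtain ⟨x, hx, hyx⟩ := mem_iUnion₂.1 hyU
        have : y = x := hUD x ⟨hyx, ht.1 hy⟩
        exact hyF (hF.mem_toFinset.2 (this ▸ hx))
      simp [hf2 y hyU, hpe]
  obtain ⟨K, hK, f₀, -, hf₀, hf₀A⟩ := exists_isCompact_of_not_isClosed
    (fun h : IsClosed (⋃ n, A n) => hgA (h.closure_eq ▸ hgcl))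
  have hlarge : ∀ m : ℕ, ∃ n ≥ m, ∃ f ∈ K, f ∈ A n := by
    by_contra! hcon
    obtain ⟨m, hm⟩ := hcon
    have hsub : K ∩ (⋃ n, A n) ⊆ ⋃ n ∈ {n | n < m}, A n := by
      rintro f ⟨hfK, hf⟩
      obtain ⟨n, hn⟩ := mem_iUnion.1 hf
      exact mem_biUnion (show n ∈ {n | n < m} from not_le.1 fun h => hm n h f hfK hn) hn
    have hcl := closure_minimal hsub ((finite_lt_nat m).isClosed_biUnion fun n _ => hAclosed n)
    obtain ⟨n, -, hn⟩ := mem_iUnion₂.1 (hcl hf₀)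
    exact hf₀A (mem_iUnion.2 ⟨n, hn⟩)
  choose ν hν f hfK hfA using hlarge
  refine (countable_iUnion fun m => (hAfin _ _ (hfA m)).countable).mono fun x hx => ?_
  obtain ⟨M, hM⟩ := hK.bddAbove_image (hcont x).continuousOn
  obtain ⟨m, hm⟩ := exists_nat_gt M
  refine mem_iUnion.2 ⟨m, hx, ?_⟩
  exact ((hM (mem_image_of_mem _ (hfK m))).trans_lt hm).trans_le (by exact_mod_cast hν m)

/-- It suffices that the functions differing from `b` only on a countably covered set form a closed
set, since the constant `a` is in its closure. Otherwise a compact `K` and a bad limit `g` yield,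
along ω₁, functions `f_i` and points `z_i` whose cluster points violate local constancy. -/
theorem isBaireLindelof_of_compactlyCoherentSpace [TopologicalSpace.MetrizableSpace E]
    [CompactlyCoherentSpace H] (hloc : ∀ f ∈ H, IsZeroSetLocallyConstant f) {a b : E}
    (hab : a ≠ b) (hH : ∀ S ∈ zeroSets X, twoValued S a b ∈ H)
    (hcount : ∀ D : Set X, (∀ x, ∃ U ∈ zeroSets X, x ∈ U ∧ (U ∩ D).Countable) → D.Countable) :
    IsBaireLindelof X := by
  intro O hO hxO
  let A : Set H := {f : H | ∃ C : Set X, C.Countable ∧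
    ∀ x, (f : X → E) x ≠ b → ∃ c ∈ C, x ∈ O c}
  suffices hA : IsClosed A by
    have hmem : (⟨_, hH _ univ_mem_zeroSets⟩ : H) ∈ A := by
      refine hA.closure_eq ▸ mem_closure_of_forall_finite_eqOn fun F hF => ?_
      refine ⟨⟨_, hH (⋃ x ∈ F, O x) (biUnion_mem_zeroSets hF fun x _ => hO x)⟩,
        ⟨F, hF.countable, fun x hx => ?_⟩, fun x hx => ?_⟩
      · by_contra hcon
        refine hx (twoValued_of_notMem fun hxF => hcon ?_)
        obtain ⟨c, hc, hxc⟩ := mem_iUnion₂.1 hxF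
        exact ⟨c, hc, hxc⟩
      · exact (twoValued_of_mem (mem_biUnion hx (hxO x))).trans
          (twoValued_of_mem (mem_univ x)).symm
    obtain ⟨C, hC, hCcov⟩ := hmem
    refine ⟨C, hC, fun y => hCcov y ?_⟩
    change twoValued univ a b y ≠ b
    rwa [twoValued_of_mem (mem_univ y)]
  by_contra hA
  obtain ⟨K, hK, g, -, hg, hgA⟩ := exists_isCompact_of_not_isClosed hA
  obtain ⟨I, _, _, hI, hIunc⟩ := exists_uncountable_wellOrder
  have hnew : ∀ C : Set X, C.Countable → ∃ z, (g : X → E) z ≠ b ∧ ∀ c ∈ C, z ∉ O c := by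
    intro C hC
    by_contra! hcon
    exact hgA ⟨C, hC, hcon⟩
  have : Nonempty (↥(K ∩ A) × X) := by
    obtain ⟨z, -⟩ := hnew ∅ countable_empty
    obtain ⟨f, hf⟩ := closure_nonempty_iff.1 ⟨g, hg⟩
    exact ⟨⟨f, hf⟩, z⟩
  -- Each pair is `(f_i, z_i)`: `f_i` agrees with `g` at the earlier points, and `z_i` is a point
  -- with `g z_i ≠ b` at which `f_i` and all earlier functions equal `b`.
  obtain ⟨u, hu⟩ := exists_recursive_choice (I := I) (T := ↥(K ∩ A) × X)
    (fun _ S t => (g : X → E) t.2 ≠ b ∧ ((t.1 : H) : X → E) t.2 = b ∧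
      ∀ s ∈ S, ((t.1 : H) : X → E) s.2 = (g : X → E) s.2 ∧ ((s.1 : H) : X → E) t.2 = b) (by
    intro i v
    have hS := (hI i).image v
    obtain ⟨f, hf, hfg⟩ := exists_mem_eqOn_of_mem_closure hK hg (hS.image Prod.snd)
    choose C hC hCcov using fun f : ↥(K ∩ A) => f.2.2
    obtain ⟨z, hgz, hz⟩ := hnew (C ⟨f, hf⟩ ∪ ⋃ s ∈ v '' {j | j < i}, C s.1)
      ((hC _).union (hS.biUnion fun s _ => hC s.1))
    have hzero : ∀ f' : ↥(K ∩ A), (∀ c ∈ C f', z ∉ O c) → ((f' : H) : X → E) z = b := by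
      intro f' hf'
      by_contra hne
      obtain ⟨c, hc, hzc⟩ := hCcov f' z hne
      exact hf' c hc hzc
    exact ⟨(⟨f, hf⟩, z), hgz, hzero _ fun c hc => hz c (Or.inl hc), fun s hs =>
      ⟨hfg _ (mem_image_of_mem _ hs), hzero _ fun c hc => hz c (Or.inr (mem_biUnion hs hc))⟩⟩)
  have hgz : ∀ i, (g : X → E) (u i).2 ≠ b := fun i => (hu i).1
  have hfg : ∀ j i, j < i → (((u i).1 : H) : X → E) (u j).2 = (g : X → E) (u j).2 :=
    fun j i hji => ((hu i).2.2 _ ⟨j, hji, rfl⟩).1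
  have hfb : ∀ j i, j < i → (((u j).1 : H) : X → E) (u i).2 = b :=
    fun j i hji => ((hu i).2.2 _ ⟨j, hji, rfl⟩).2
  have hinj : Function.Injective fun i => (u i).2 := by
    have hne : ∀ j i, j < i → (u j).2 ≠ (u i).2 := fun j i hji h => hgz j <| by
      rw [← hfg j i hji, h]
      exact (hu i).2.1
    intro i j h
    rcases lt_trichotomy i j with hij | hij | hij
    · exact absurd h (hne i j hij)
    · exact hij
    · exact absurd h.symm (hne j i hij)
  -- The `z_i` are uncountably many, hence not locally countable. At this condensation point every
  -- `f_i` equals `b`, so a cluster point `f` does too, although `f z_j = g z_j ≠ b` for all `j`.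
  obtain ⟨x, hx⟩ : ∃ x, ∀ U ∈ zeroSets X, x ∈ U → ¬ (U ∩ range fun i => (u i).2).Countable := by
    by_contra! hcon
    refine hIunc (countable_univ_iff.1 (MapsTo.countable_of_injOn (t := range fun i => (u i).2)
      (fun i _ => mem_range_self i) hinj.injOn (hcount _ hcon)))
  have hfreq : ∀ U ∈ zeroSets X, x ∈ U → ∀ i, ∃ j > i, (u j).2 ∈ U := by
    intro U hU hxU i
    by_contra! hcon
    refine hx U hU hxU ((((hI i).insert i).image fun i => (u i).2).mono ?_)
    rintro _ ⟨hyU, j, rfl⟩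
    refine mem_image_of_mem _ ?_
    rcases lt_trichotomy j i with hij | hij | hij
    · exact Or.inr hij
    · exact Or.inl hij
    · exact absurd hyU (hcon j hij)
  have hfx : ∀ i, (((u i).1 : H) : X → E) x = b := by
    intro i
    obtain ⟨S, hS, hxS, hSf⟩ := hloc _ (u i).1.1.2 x
    obtain ⟨j, hij, hj⟩ := hfreq S hS hxS i
    rw [← hSf _ hj]
    exact hfb i j hij
  have : Nonempty I := by
    by_contra hemp
    have := not_nonempty_iff.1 hemp
    exact hIunc inferInstance
  obtain ⟨f, -, hf⟩ := hK.exists_mapClusterPt (f := atTop) (u := fun i => ((u i).1 : H))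
    (tendsto_principal.2 (Eventually.of_forall fun i => (u i).1.2.1))
  have hfx' : (f : X → E) x = b :=
    eval_eq_of_mapClusterPt hf (tendsto_const_nhds.congr fun i => (hfx i).symm)
  have hfz : ∀ j, (f : X → E) (u j).2 = (g : X → E) (u j).2 := by
    intro j
    obtain ⟨i₀, hi₀, -⟩ := hfreq univ univ_mem_zeroSets (mem_univ x) j
    refine eval_eq_of_mapClusterPt hf (tendsto_const_nhds.congr' ?_)
    filter_upwards [eventually_ge_atTop i₀] with i hi
    exact (hfg j i (hi₀.trans_le hi)).symm
  obtain ⟨S, hS, hxS, hSf⟩ := hloc f f.2 x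
  obtain ⟨j, -, hj⟩ := hfreq S hS hxS (Classical.arbitrary I)
  exact hgz j (by rw [← hfz j, hSf _ hj, hfx'])

end FunctionSpace

end BaireFun

theorem theoremt
    {𝕜 E X : Type*} [RCLike 𝕜]
    [AddCommGroup E] [Module ℝ E] [Module 𝕜 E] [IsScalarTower ℝ 𝕜 E]
    [TopologicalSpace E] [IsTopologicalAddGroup E] [ContinuousSMul 𝕜 E]
    [LocallyConvexSpace ℝ E] [TopologicalSpace.MetrizableSpace E] [Nontrivial E]
    [TopologicalSpace X] [T35Space X]
    (H : Set (X → E))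
    (hH : H ⊆ BaireFun.baireFunctions X E)
    (hH' : BaireFun.stableBaireOneRC X E ⊆ H) :
    List.TFAE
      [TopologicalSpace.MetrizableSpace H,
       BaireFun.IsSigmaSpace H,
       BaireFun.HasCountableCsStarCharacter H,
       Countable X] ∧
    List.TFAE
      [FrechetUrysohnSpace H,
       SequentialSpace H,
       CompactlyCoherentSpace H,
       BaireFun.HasCountableTightness H,
       @BaireFun.HasPropertyGamma X (BaireFun.baireTopology X)] := by
  have : ContinuousSMul ℝ E := IsScalarTower.continuousSMul 𝕜
  have hstep : ∀ S ∈ BaireFun.zeroSets X, ∀ a b : E, BaireFun.twoValued S a b ∈ H :=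
    fun S hS a b => hH' (BaireFun.twoValued_mem_stableBaireOneRC hS a b)
  have hloc : ∀ f ∈ H, BaireFun.IsZeroSetLocallyConstant f := fun f hf =>
    BaireFun.isZeroSetLocallyConstant_of_mem_baireFunctions (hH hf)
  obtain ⟨e₀, he₀⟩ := exists_ne (0 : E)
  -- Local convexity enters here: the functional `p` measures the size of values in the k-space
  -- argument.
  obtain ⟨p, hp⟩ := geometric_hahn_banach_point_point he₀.symm
  rw [map_zero] at hp
  obtain ⟨e, hpe, he⟩ : ∃ e, p e = 1 ∧ e ≠ 0 := by
    refine ⟨(p e₀)⁻¹ • e₀, ?_, smul_ne_zero (inv_ne_zero hp.ne') he₀⟩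
    rw [map_smul, smul_eq_mul, inv_mul_cancel₀ hp.ne']
  have : T3Space E := by
    let := TopologicalSpace.metrizableSpaceMetric E
    infer_instance
  constructor
  · tfae_have 4 → 1 := fun _ => BaireFun.metrizableSpace_of_countable
    tfae_have 1 → 2 := fun _ => BaireFun.isSigmaSpace_of_metrizableSpace
    tfae_have 1 → 3 := fun _ => BaireFun.hasCountableCsStarCharacter_of_firstCountable
    tfae_have 2 → 4 := BaireFun.countable_of_isSigmaSpace he fun S hS => hstep S hS e 0
    tfae_have 3 → 4 :=
      BaireFun.countable_of_hasCountableCsStarCharacter he fun S hS => hstep S hS e 0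
    tfae_finish
  · tfae_have 1 → 2 := fun _ => inferInstance
    tfae_have 2 → 3 := fun _ => inferInstance
    tfae_have 1 → 4 := fun _ => BaireFun.hasCountableTightness_of_frechetUrysohnSpace
    tfae_have 4 → 5 := fun h =>
      (BaireFun.hasCountableOmegaSubcovers_of_hasCountableTightness he
        (fun S hS => hstep S hS e 0) h).hasPropertyGamma
    tfae_have 3 → 5 := fun _ =>
      (BaireFun.isBaireLindelof_of_compactlyCoherentSpace hloc he
        (fun S hS => hstep S hS e 0) fun D hD =>
          BaireFun.countable_of_forall_exists_zeroSet hstep hpe hD)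
        |>.hasCountableOmegaSubcovers.hasPropertyGamma
    tfae_have 5 → 1 := BaireFun.frechetUrysohnSpace_of_hasPropertyGamma hloc
    tfae_finish
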